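/- **Model.** An instance consists of a finite directed multigraph $G=(V,E)$ with a source $s$ and a sink $t\neq s$, transit times $\tau_e\ge 0$, capacities $\nu_e>0$ and costs $c_e\ge 0$ for $e\in E$, a constant inflow rate $u>0$ and a deadline $D>0$. Let $\mathcal P$ be the set of simple directed $s,t$-paths and $c_P=\sum_{e\in P}c_e$. A flow over time $f$ is given by measurable path inflow rates $f_P^+:[0,\infty)\to[0,\infty)$, $P\in\mathcal P$, with $\sum_P f_P^+(\theta)=u$ for all $\theta\ge0$, which are propagated through the network by the fluid queuing model: if $f_e^+$ is the (induced) inflow rate into $e$, the queue mass $z_e$ at the tail of $e$ satisfies $z_e(0)=0$, and for almost every $\theta$ it holds that $z_e'(\theta)=f_e^+(\theta)-\nu_e$ if $z_e(\theta)>0$ and $z_e'(\theta)=\max\{f_e^+(\theta)-\nu_e,0\}$ if $z_e(\theta)=0$; a particle entering $e$ at time $x$ leaves $e$ at time $x+z_e(x)/\nu_e+\tau_e$ and then immediately enters the next edge of its path. Let $\ell^P_t(\theta)$ be the time at which a particle that leaves $s$ at time $\theta$ along $P$ reaches $t$. Put $c_P(\theta)=c_P$ if $\ell^P_t(\theta)<D$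 and $c_P(\theta)=\infty$ otherwise. The flow $f$ is a *Nash flow* if for all $\theta\ge0$ and $P\in\mathcal P$, $f^+_P(\theta)>0$ implies $c_P(\theta)\le c_Q(\theta)$ for all $Q\in\mathcal P$. Let $M_f$ be the amount of flow that reaches $t$ before time $D$ under $f$, let $M^*=\sup_f M_f$ over all flows over time, let $M=\inf M_f$ over all Nash flows, and let $D^*(x)$ be the infimum of the times $T\ge 0$ for which some flow over time sends at least $x$ units to $t$ before time $T$. The *throughput-price of anarchy* is $\sup_{f\text{ Nash}} M^*/M_f$, and the *makespan-price of anarchy* is $D/D^*(M)$. **Theorem.** Even in series-parallel networks (two-terminal directed series-parallel graphs with terminals $s$ and $t$), the throughput-price of anarchy and the makespan-price of anarchy are unbounded: for every $B$ there is an instance on a series-parallel network with $M>0$ whose throughput-price of anarchy is at least $B$, and there is one with $M>0$ whose makespan-price of anarchy is at least $B$. More precisely, for every integer $k\ge1$ consider the following instance with $u=1$, all capacities equal to $1$ and $D=k+2$. It consists of $k$ gadgets connected in series; the $i$-th gadget ($i=1,\dots,k$) consists of two parallel edges (an upper edge with transit time $1$ and cost $0$, and a lower edge with transit time $0$ and cost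 $2^{k-i}$) followed by a single edge with transit time $0$ and cost $0$. This network is series-parallel, it satisfies $M>0$, there is a Nash flow $f$ with $M_f=2$, $M^*/M_f\ge 1+k/2$ and $D/D^*(M_f)\ge 1+k/2$, and both prices of anarchy of this instance are at least $1+k/2$. -/

import Mathlib

open scoped ENNReal NNReal

noncomputable section

namespace DeadlineFlow

/-- An instance: a directed multigraph with vertex set `V` and edge set `E` (edge `e` leads from
`tail e` to `head e`), a source `s`, a sink `t`, transit times `τ`, capacities `ν`, costs `c`,
a constant network inflow rate `u` and a deadline `D`. -/
structure Network (V E : Type) where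
  tail : E → V
  head : E → V
  s : V
  t : V
  s_ne_t : s ≠ t
  τ : E → ℝ
  τ_nonneg : ∀ e, 0 ≤ τ e
  ν : E → ℝ
  ν_pos : ∀ e, 0 < ν e
  c : E → ℝ
  c_nonneg : ∀ e, 0 ≤ c e
  u : ℝ
  u_pos : 0 < u
  D : ℝ
  D_pos : 0 < D

/-- `IsSPBetween tail head a b W F`: the subgraph with vertex set `W` and edge set `F` is a
(directed, two-terminal) series-parallel graph with source `a` and sink `b`. -/
inductive IsSPBetween {V E : Type} (tail head : E → V) : V → V → Set V → Set E → Prop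
  /-- a single edge -/
  | edge (e : E) (h : tail e ≠ head e) :
      IsSPBetween tail head (tail e) (head e) {tail e, head e} {e}
  /-- series composition: the sink of the first graph is the source of the second one, and the
  two graphs share nothing else -/
  | series {a b d : V} {W₁ W₂ : Set V} {F₁ F₂ : Set E}
      (h₁ : IsSPBetween tail head a b W₁ F₁) (h₂ : IsSPBetween tail head b d W₂ F₂)
      (hW : W₁ ∩ W₂ = {b}) (hF : Disjoint F₁ F₂) :
      IsSPBetween tail head a d (W₁ ∪ W₂) (F₁ ∪ F₂)
  /-- parallel composition: the two graphs have the same source and the same sink, and share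
  nothing else -/
  | parallel {a b : V} {W₁ W₂ : Set V} {F₁ F₂ : Set E}
      (h₁ : IsSPBetween tail head a b W₁ F₁) (h₂ : IsSPBetween tail head a b W₂ F₂)
      (hW : W₁ ∩ W₂ = {a, b}) (hF : Disjoint F₁ F₂) :
      IsSPBetween tail head a b (W₁ ∪ W₂) (F₁ ∪ F₂)

namespace Network

variable {V E : Type} (N : Network V E)

/-- The whole network is series-parallel with terminals `s` and `t`. -/
def IsSeriesParallel : Prop :=
  IsSPBetween N.tail N.head N.s N.t Set.univ Set.univ

/-- The list of edges `p` is a directed walk from `a` to `b`. -/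
def IsWalk : V → List E → V → Prop
  | a, [], b => a = b
  | a, e :: p, b => N.tail e = a ∧ IsWalk (N.head e) p b

/-- The set of all (simple, directed) `s`,`t`-paths, given by their lists of edges. -/
def Path : Type :=
  {p : List E // N.IsWalk N.s p N.t ∧ (N.s :: p.map N.head).Nodup}

/-- The list of edges of a path, in the order of travel. -/
def Path.edges {N : Network V E} (P : N.Path) : List E := P.1

theorem Path.nodup_edges {N : Network V E} (P : N.Path) : P.edges.Nodup :=
  List.Nodup.of_map N.head (List.nodup_cons.1 P.2.2).2

open scoped Classical in
instance instFintypePath [Fintype E] : Fintype N.Path :=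
  Fintype.ofInjective (fun P : N.Path => (⟨P.edges, P.nodup_edges⟩ : {l : List E // l.Nodup}))
    (fun _ _ h => Subtype.ext (congrArg (fun l : {l : List E // l.Nodup} => l.1) h))

/-- The cost `c_P` of a path. -/
def pathCost (P : N.Path) : ℝ := (P.edges.map N.c).sum

/-- `T_e(x)`: the time at which a particle that enters `e` at time `x` leaves `e`, when `z` are
the queue masses. -/
def exitTime (z : E → ℝ → ℝ) (e : E) (x : ℝ) : ℝ := x + z e x / N.ν e + N.τ e

/-- The time at which a particle that enters the first edge of `p` at time `θ` leaves the last
edge of `p`. -/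
def traverse (z : E → ℝ → ℝ) : List E → ℝ → ℝ
  | [], θ => θ
  | e :: p, θ => traverse z p (N.exitTime z e θ)

open scoped Classical in
/-- `ℓ^P_v(θ)` for the tail `v` of the edge `e` of `P`: the time at which particle `θ` reaches `e`
when it travels along `P`. -/
def entryTime (z : E → ℝ → ℝ) (P : N.Path) (e : E) (θ : ℝ) : ℝ :=
  N.traverse z (P.edges.takeWhile (fun e' => decide (e' ≠ e))) θ

/-- `ℓ^P_t(θ)`: the time at which particle `θ` reaches the sink when it travels along `P`. -/
def arrivalTime (z : E → ℝ → ℝ) (P : N.Path) (θ : ℝ) : ℝ := N.traverse z P.edges θ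

end Network

open scoped Classical in
/-- A flow over time, given by its path inflow rates `f_P^+`, together with the edge inflow rates
`f_e^+` and the queue masses `z_e` which they induce. Only times `≥ 0` matter; the network is empty
at time `0`. -/
structure FlowOverTime {V E : Type} [Fintype E] (N : Network V E) where
  pathRate : N.Path → ℝ → ℝ
  edgeRate : E → ℝ → ℝ
  queue : E → ℝ → ℝ
  measurable_pathRate : ∀ P, Measurable (pathRate P)
  pathRate_nonneg : ∀ P θ, 0 ≤ pathRate P θ
  /-- flow leaves the source at rate `u` -/
  sum_pathRate : ∀ θ, 0 ≤ θ → ∑ P, pathRate P θ = N.u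
  edgeRate_nonneg : ∀ e θ, 0 ≤ edgeRate e θ
  edgeRate_integrable : ∀ e x, 0 ≤ x → IntervalIntegrable (edgeRate e) MeasureTheory.volume 0 x
  queue_nonneg : ∀ e θ, 0 ≤ queue e θ
  queue_continuousOn : ∀ e, ContinuousOn (queue e) (Set.Ici 0)
  /-- the queue dynamics, `z_e' = f_e^+ - ν_e` where `z_e > 0` and `z_e' = max (f_e^+ - ν_e) 0`
  where `z_e = 0`, with `z_e(0) = 0`, in integrated form -/
  queue_dynamics : ∀ e x, 0 ≤ x → queue e x =
    ∫ y in (0 : ℝ)..x,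
      if 0 < queue e y then edgeRate e y - N.ν e else max (edgeRate e y - N.ν e) 0
  /-- every particle is tracked along its path: the flow that enters `e` up to time `x` consists
  of the particles on paths through `e` that reach `e` up to time `x` -/
  loading : ∀ e x, 0 ≤ x → ∫ y in (0 : ℝ)..x, edgeRate e y =
    ∑ P with e ∈ P.edges,
      ∫ ξ in {ξ : ℝ | 0 ≤ ξ ∧ N.entryTime queue P e ξ ≤ x}, pathRate P ξ

namespace FlowOverTime

variable {V E : Type} [Fintype E] {N : Network V E} (f : FlowOverTime N)

open scoped Classical in
/-- The cost `c_P(θ)` of particle `θ` along `P`. -/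
def cost (P : N.Path) (θ : ℝ) : EReal :=
  if N.arrivalTime f.queue P θ < N.D then (N.pathCost P : EReal) else ⊤

/-- Nash flows over time. -/
def IsNash : Prop :=
  ∀ θ, 0 ≤ θ → ∀ P, 0 < f.pathRate P θ → ∀ Q, f.cost P θ ≤ f.cost Q θ

/-- The amount of flow that arrives at the sink before time `T`. -/
def amountBefore (T : ℝ) : ℝ :=
  ∑ P, ∫ θ in {θ : ℝ | 0 ≤ θ ∧ N.arrivalTime f.queue P θ < T}, f.pathRate P θ

/-- `M_f`: the amount of flow that arrives at the sink before the deadline. -/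
def amount : ℝ := f.amountBefore N.D

end FlowOverTime

namespace Network

variable {V E : Type} [Fintype E] (N : Network V E)

/-- `M^*`: the maximum amount of flow that arrives before the deadline, over all flows. -/
def optAmount : ℝ≥0∞ := ⨆ f : FlowOverTime N, ENNReal.ofReal f.amount

/-- `M`: the smallest amount of flow that arrives before the deadline, over all Nash flows. -/
def worstNashAmount : ℝ≥0∞ := ⨅ (f : FlowOverTime N) (_ : f.IsNash), ENNReal.ofReal f.amount

/-- `D^*(M)`: the earliest time such that some flow over time sends `M` units of flow to the sink
before that time. -/
def quickestTime (M : ℝ≥0∞) : ℝ≥0∞ :=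
  ⨅ (T : ℝ) (_ : 0 ≤ T) (_ : ∃ f : FlowOverTime N, M ≤ ENNReal.ofReal (f.amountBefore T)),
    ENNReal.ofReal T

/-- The throughput-price of anarchy. -/
def throughputPoA : ℝ≥0∞ :=
  ⨆ (f : FlowOverTime N) (_ : f.IsNash), N.optAmount / ENNReal.ofReal f.amount

/-- The makespan-price of anarchy. -/
def makespanPoA : ℝ≥0∞ := ENNReal.ofReal N.D / N.quickestTime N.worstNashAmount

end Network

/-- `k` gadgets in series. Gadget `i` (counted from `0`) consists of two parallel edges, the upper
edge `(i, 0)` and the lower edge `(i, 1)`, from vertex `2i` to vertex `2i + 1`, followed by the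
single edge `(i, 2)` from vertex `2i + 1` to vertex `2i + 2`. Upper edges have transit time `1`,
all other edges `0`; lower edge `i` has cost `2 ^ (k - 1 - i)`, all other edges `0`. -/
def gadgetNetwork (k : ℕ) (hk : 0 < k) : Network (Fin (2 * k + 1)) (Fin k × Fin 3) where
  tail e := ⟨if e.2 = 2 then 2 * e.1 + 1 else 2 * e.1, by have := e.1.2; split <;> omega⟩
  head e := ⟨if e.2 = 2 then 2 * e.1 + 2 else 2 * e.1 + 1, by have := e.1.2; split <;> omega⟩
  s := ⟨0, by omega⟩
  t := ⟨2 * k, by omega⟩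
  s_ne_t h := by
    have := congrArg Fin.val h
    simp only at this
    omega
  τ e := if e.2 = 0 then 1 else 0
  τ_nonneg e := by split <;> norm_num
  ν _ := 1
  ν_pos _ := one_pos
  c e := if e.2 = 1 then 2 ^ (k - 1 - (e.1 : ℕ)) else 0
  c_nonneg e := by split <;> positivity
  u := 1
  u_pos := one_pos
  D := k + 2
  D_pos := by positivity

end DeadlineFlow

end

noncomputable section

namespace DeadlineFlow

open MeasureTheory

/-! ### General facts on flows over time and Nash flows. -/

section Flows

namespace Network

variable {V E : Type} (N : Network V E)

/-! If everybody takes the lower edges there are no queues and no delays, so `k + 2` units meet the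
deadline, and 2 units arrive before time 2. The Nash flow wastes one time unit per gadget instead.

Write the time at which a particle enters gadget `i` (counted from 0) as `i + w`. Particles with `w
< 1` take the upper edge and reach the last edge at `i + 1 + w`; those with `1 ≤ w < 2` take the
lower edge and get there at `i + w`. Both streams fill the interval `[i + 1, i + 2)`, so a queue of
mass 1 builds up. The exit times are `i + 1 + 2w` and `i + 1 + (2w - 2)`: the shifted time evolves
by the doubling map of `[0, 2)`. From `i + 2` on the queue stays at 1, and `w ≥ 2` is a fixed point
(`exitTime_gadget`). The doubling map preserves Lebesgue measure (`measurePreserving_doubling`), so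
every gadget sees unit inflow again and the construction repeats (`loading_nash`). Particle `θ`
reaches the sink at `k + doubling^[k] θ`, which is before `k + 2` exactly if `θ < 2`; hence the
amount is 2.

This is an equilibrium (`late_or_sum_cost_le`). A particle with `w ≥ 1` that takes the upper edge
leaves the gadget with shifted time at least 2 and can never catch up. A particle with `w < 1` can
afford the upper edge, and the lower edge costs more than all later lower edges together.

That no Nash flow delivers nothing is a crude estimate: in any flow a queue is at most as large as
the elapsed time, so very early particles can meet the deadline along the lower path, and in
equilibrium they meet it (`FlowOverTime.IsNash.le_amount`). -/

theorem le_exitTime {z : E → ℝ → ℝ} (hz : ∀ e x, 0 ≤ z e x) (e : E) (x : ℝ) :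
    x ≤ N.exitTime z e x := by
  have h1 := div_nonneg (hz e x) (N.ν_pos e).le
  have h2 := N.τ_nonneg e
  unfold exitTime
  linarith

theorem le_traverse {z : E → ℝ → ℝ} (hz : ∀ e x, 0 ≤ z e x) (p : List E) (θ : ℝ) :
    θ ≤ N.traverse z p θ := by
  induction p generalizing θ with
  | nil => exact le_rfl
  | cons e p ih => exact (N.le_exitTime hz e θ).trans (ih _)

end Network

namespace FlowOverTime

variable {V E : Type} [Fintype E] {N : Network V E} (f : FlowOverTime N)

theorem pathRate_le (P : N.Path) {θ : ℝ} (hθ : 0 ≤ θ) : f.pathRate P θ ≤ N.u := by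
  rw [← f.sum_pathRate θ hθ]
  exact Finset.single_le_sum (f := fun Q => f.pathRate Q θ)
    (fun Q _ => f.pathRate_nonneg Q θ) (Finset.mem_univ P)

theorem integrableOn_pathRate (P : N.Path) (x : ℝ) :
    IntegrableOn (f.pathRate P) (Set.Icc 0 x) := by
  refine Measure.integrableOn_of_bounded (M := N.u) (by simp)
    (f.measurable_pathRate P).aestronglyMeasurable ?_
  filter_upwards [ae_restrict_mem measurableSet_Icc] with θ hθ
  rw [Real.norm_of_nonneg (f.pathRate_nonneg P θ)]
  exact f.pathRate_le P hθ.1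

theorem sum_integral_pathRate {s : Set ℝ} {x : ℝ} (hs : MeasurableSet s)
    (hsx : s ⊆ Set.Icc 0 x) :
    ∑ P, ∫ θ in s, f.pathRate P θ = volume.real s * N.u := by
  rw [← integral_finsetSum _ fun P _ => (f.integrableOn_pathRate P x).mono_set hsx,
    setIntegral_congr_fun hs fun θ hθ => f.sum_pathRate θ (hsx hθ).1, setIntegral_const,
    smul_eq_mul]

/-- At most the flow that has left the source by time `x` can be queued at time `x`. -/
theorem queue_le (e : E) {x : ℝ} (hx : 0 ≤ x) : f.queue e x ≤ N.u * x := by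
  classical
  have hle : f.queue e x ≤ ∫ y in (0 : ℝ)..x, f.edgeRate e y := by
    have hz := f.queue_dynamics e x hx
    by_cases hi : IntervalIntegrable (fun y => if 0 < f.queue e y then f.edgeRate e y - N.ν e
        else max (f.edgeRate e y - N.ν e) 0) volume 0 x
    · rw [hz]
      refine intervalIntegral.integral_mono_on hx hi (f.edgeRate_integrable e x hx) fun y _ => ?_
      have h1 := f.edgeRate_nonneg e y
      have h2 := N.ν_pos e
      split_ifs
      · linarith
      · exact max_le (by linarith) h1
    -- A non-integrable integrand makes the integral, and hence the queue, 0 by convention, so the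
    -- bound survives.
    · rw [hz, intervalIntegral.integral_undef hi]
      exact intervalIntegral.integral_nonneg hx fun y _ => f.edgeRate_nonneg e y
  refine hle.trans ?_
  rw [f.loading e x hx]
  have hsum := f.sum_integral_pathRate (s := Set.Icc 0 x) measurableSet_Icc subset_rfl
  rw [Real.volume_real_Icc_of_le hx, sub_zero, mul_comm] at hsum
  rw [← hsum]
  refine (Finset.sum_le_sum fun P _ => ?_).trans (Finset.sum_le_univ_sum_of_nonneg fun P =>
    integral_nonneg fun θ => f.pathRate_nonneg P θ)
  refine setIntegral_mono_set (f.integrableOn_pathRate P x)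
    (Filter.Eventually.of_forall fun θ => f.pathRate_nonneg P θ)
    (LE.le.eventuallyLE fun θ hθ => ⟨hθ.1, (N.le_traverse f.queue_nonneg _ θ).trans hθ.2⟩)

/-- In a Nash flow all particles that can meet the deadline do meet it. -/
theorem IsNash.le_amount {f : FlowOverTime N} (hf : f.IsNash) {ε : ℝ} (hε : 0 ≤ ε) (Q : N.Path)
    (hQ : ∀ θ, 0 ≤ θ → θ < ε → N.arrivalTime f.queue Q θ < N.D) : ε * N.u ≤ f.amount := by
  have hsum := f.sum_integral_pathRate (s := Set.Ico 0 ε) measurableSet_Ico Set.Ico_subset_Icc_self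
  rw [Real.volume_real_Ico_of_le hε, sub_zero] at hsum
  rw [← hsum]
  refine Finset.sum_le_sum fun P _ => ?_
  have hm : MeasurableSet {θ | 0 < f.pathRate P θ} :=
    measurableSet_lt measurable_const (f.measurable_pathRate P)
  -- The equilibrium condition speaks only about times at which `P` is used, so the other times,
  -- which contribute 0, are discarded first.
  rw [setIntegral_eq_of_subset_of_forall_sdiff_eq_zero measurableSet_Ico
    (Set.inter_subset_left (t := {θ | 0 < f.pathRate P θ}))
    fun θ hθ => le_antisymm (not_lt.1 fun h => hθ.2 ⟨hθ.1, h⟩) (f.pathRate_nonneg P θ)]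
  refine setIntegral_mono_set ((f.integrableOn_pathRate P N.D).mono_set
      fun θ hθ => ⟨hθ.1, ((N.le_traverse f.queue_nonneg _ θ).trans_lt hθ.2).le⟩)
    (Filter.Eventually.of_forall fun θ => f.pathRate_nonneg P θ)
    (LE.le.eventuallyLE fun θ hθ => ⟨hθ.1.1, ?_⟩)
  have h := hf θ hθ.1.1 P hθ.2 Q
  -- If `P` were late, its cost would be `⊤`, whereas `Q` has finite cost.
  by_contra hP
  rw [cost, cost, if_neg hP, if_pos (hQ θ hθ.1.1 hθ.1.2)] at h
  exact absurd h (not_le.2 (EReal.coe_lt_top _))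

end FlowOverTime

/-- If the whole unit inflow takes path `p θ` at time `θ`, then the sum over the paths in `s` of the
amounts that enter them during `A i` is the measure of one set of times. -/
theorem sum_integral_indicator {ι : Type} (p : ℝ → ι) (hp : ∀ i, MeasurableSet (p ⁻¹' {i}))
    (s : Finset ι) (A : ι → Set ℝ) (B : Set ℝ) (hB : volume B ≠ ∞)
    (hAB : ∀ θ, p θ ∈ s → (θ ∈ A (p θ) ↔ θ ∈ B)) :
    ∑ i ∈ s, ∫ θ in A i, (p ⁻¹' {i}).indicator 1 θ = volume.real {θ | p θ ∈ s ∧ θ ∈ B} := by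
  have : IsFiniteMeasure (volume.restrict B) := ⟨by simpa using hB.lt_top⟩
  have hs : MeasurableSet (p ⁻¹' (s : Set ι)) := by
    rw [← Set.biUnion_preimage_singleton]
    exact Finset.measurableSet_biUnion s fun i _ => hp i
  have h : volume.real {θ | p θ ∈ s ∧ θ ∈ B} = (volume.restrict B).real (p ⁻¹' (s : Set ι)) := by
    rw [measureReal_restrict_apply hs]
    rfl
  rw [h, ← sum_measureReal_preimage_singleton s fun i _ => hp i]
  refine Finset.sum_congr rfl fun i hi => ?_
  rw [integral_indicator_one (hp i), measureReal_restrict_apply (hp i),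
    measureReal_restrict_apply (hp i)]
  congr 1
  ext θ
  constructor
  · rintro ⟨rfl, h⟩
    exact ⟨rfl, (hAB θ hi).1 h⟩
  · rintro ⟨rfl, h⟩
    exact ⟨rfl, (hAB θ hi).2 h⟩

theorem intervalIntegral_indicator_one {A : Set ℝ} (hA : MeasurableSet A) (hA0 : A ⊆ Set.Ici 0)
    {x : ℝ} (hx : 0 ≤ x) :
    ∫ y in (0 : ℝ)..x, A.indicator 1 y = volume.real (A ∩ Set.Iic x) := by
  rw [intervalIntegral.integral_of_le hx, ← integral_Icc_eq_integral_Ioc,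
    integral_indicator_one hA, measureReal_restrict_apply hA]
  congr 1
  ext y
  exact ⟨fun h => ⟨h.1, h.2.2⟩, fun h => ⟨h.1, hA0 h.1, h.2⟩⟩

theorem intervalIntegrable_indicator_one {A : Set ℝ} (hA : MeasurableSet A) (x y : ℝ) :
    IntervalIntegrable (A.indicator (1 : ℝ → ℝ)) volume x y :=
  ⟨(integrableOn_const (C := (1 : ℝ)) (by simp)).indicator hA,
    (integrableOn_const (C := (1 : ℝ)) (by simp)).indicator hA⟩

end Flows

/-! ### Paths and series-parallel structure of the gadget network. -/

section Gadgets

/-- The upper (`false`) or the lower (`true`) one of the two parallel edges of a gadget. -/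
def lane (b : Bool) : Fin 3 := if b then 1 else 0

/-- The walk through the last `n` gadgets that takes the lower edge of gadget `i` iff `b i`. -/
def gadgetWalk (k : ℕ) (b : ℕ → Bool) : (n i : ℕ) → i + n = k → List (Fin k × Fin 3)
  | 0, _, _ => []
  | n + 1, i, h => (⟨i, by omega⟩, lane (b i)) :: (⟨i, by omega⟩, 2) ::
      gadgetWalk k b n (i + 1) (by omega)

theorem gadgetWalk_congr {k : ℕ} {b b' : ℕ → Bool} (n i : ℕ) (h : i + n = k)
    (hb : ∀ j, i ≤ j → j < k → b j = b' j) : gadgetWalk k b n i h = gadgetWalk k b' n i h := by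
  induction n generalizing i with
  | zero => rfl
  | succ n ih =>
    rw [gadgetWalk, gadgetWalk, hb i le_rfl (by omega), ih (i + 1) _ fun j hj => hb j (by omega)]

theorem mem_gadgetWalk {k : ℕ} {b : ℕ → Bool} (n i : ℕ) (h : i + n = k) (j : Fin k) (c : Fin 3) :
    (j, c) ∈ gadgetWalk k b n i h ↔ i ≤ j ∧ (c = lane (b j) ∨ c = 2) := by
  induction n generalizing i with
  | zero =>
    simp only [gadgetWalk, List.not_mem_nil, false_iff]
    have := j.2
    omega
  | succ n ih =>
    obtain ⟨j, hj⟩ := j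
    simp only [gadgetWalk, List.mem_cons, Prod.mk.injEq, Fin.mk.injEq, ih]
    constructor
    · rintro (⟨rfl, h1⟩ | ⟨rfl, h1⟩ | ⟨h1, h2⟩)
      · exact ⟨le_rfl, Or.inl h1⟩
      · exact ⟨le_rfl, Or.inr h1⟩
      · exact ⟨by omega, h2⟩
    · rintro ⟨h1, h2⟩
      rcases h1.eq_or_lt with rfl | h1
      · rcases h2 with h2 | h2
        · exact Or.inl ⟨rfl, h2⟩
        · exact Or.inr (Or.inl ⟨rfl, h2⟩)
      · exact Or.inr (Or.inr ⟨by omega, h2⟩)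

variable {k : ℕ} {hk : 0 < k}

theorem isWalk_gadgetWalk (b : ℕ → Bool) (n i : ℕ) (h : i + n = k) :
    (gadgetNetwork k hk).IsWalk ⟨2 * i, by omega⟩ (gadgetWalk k b n i h)
      (gadgetNetwork k hk).t := by
  induction n generalizing i with
  | zero =>
    obtain rfl : i = k := by omega
    rfl
  | succ n ih =>
    refine ⟨?_, ?_, ?_⟩
    · cases hb : b i <;> simp [gadgetNetwork, lane]
    · cases hb : b i <;> simp [gadgetNetwork, lane]
    · convert ih (i + 1) (by omega) using 1
      exact Fin.ext (by simp [gadgetNetwork]; omega)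

/-- Vertex numbers increase along a walk; the lower bound on the heads is what makes the induction
for distinctness go through. -/
theorem nodup_heads_gadgetWalk (b : ℕ → Bool) (n i : ℕ) (h : i + n = k) :
    (∀ v ∈ (gadgetWalk k b n i h).map (gadgetNetwork k hk).head, 2 * i < v.1) ∧
      ((gadgetWalk k b n i h).map (gadgetNetwork k hk).head).Nodup := by
  induction n generalizing i with
  | zero => simp [gadgetWalk]
  | succ n ih =>
    obtain ⟨h1, h2⟩ := ih (i + 1) (by omega)
    have e1 : ((gadgetNetwork k hk).head (⟨i, by omega⟩, lane (b i))).1 = 2 * i + 1 := by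
      cases hb : b i <;> simp [gadgetNetwork, lane]
    have e2 : ((gadgetNetwork k hk).head (⟨i, by omega⟩, 2)).1 = 2 * i + 2 := by
      simp [gadgetNetwork]
    rw [gadgetWalk, List.map_cons, List.map_cons]
    rw [List.forall_mem_cons, List.forall_mem_cons, List.nodup_cons, List.nodup_cons,
      List.mem_cons, not_or]
    refine ⟨⟨by omega, by omega, fun v hv => by have := h1 v hv; omega⟩, ⟨?_, ?_⟩, ?_, h2⟩
    · intro h
      have := congrArg Fin.val h
      omega
    · intro h
      have := h1 _ h
      omega
    · intro h
      have := h1 _ h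
      omega

/-- The path that takes the lower edge of gadget `i` iff `b i`. -/
def gadgetPath (k : ℕ) (hk : 0 < k) (b : ℕ → Bool) : (gadgetNetwork k hk).Path :=
  ⟨gadgetWalk k b k 0 (zero_add k), isWalk_gadgetWalk b k 0 (zero_add k),
    List.nodup_cons.2 ⟨fun h => absurd
      ((nodup_heads_gadgetWalk (hk := hk) b k 0 (zero_add k)).1 _ h) (by simp [gadgetNetwork]),
      (nodup_heads_gadgetWalk b k 0 (zero_add k)).2⟩⟩

theorem edges_gadgetPath (b : ℕ → Bool) :
    (gadgetPath k hk b).edges = gadgetWalk k b k 0 (zero_add k) := rfl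

/-- At an even vertex only the two lanes of a gadget leave, at an odd vertex only its last edge, so
a walk to the sink is determined by one binary choice per gadget. Thus Nash deviations need only be
checked against the paths `gadgetPath`. -/
theorem exists_eq_gadgetWalk (n i : ℕ) (h : i + n = k) (p : List (Fin k × Fin 3))
    (hp : (gadgetNetwork k hk).IsWalk ⟨2 * i, by omega⟩ p (gadgetNetwork k hk).t) :
    ∃ b, p = gadgetWalk k b n i h := by
  induction n generalizing i p with
  | zero =>
    refine ⟨fun _ => false, ?_⟩
    cases p with
    | nil => rfl
    | cons e p =>
      have h1 := congrArg Fin.val hp.1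
      have h2 := e.1.2
      simp only [gadgetNetwork] at h1
      split_ifs at h1 <;> omega
  | succ n ih =>
    match p, hp with
    | [], hp =>
      have : 2 * i = 2 * k := congrArg Fin.val hp
      omega
    | [e], hp =>
      have h1 := congrArg Fin.val hp.1
      have h2 := congrArg Fin.val hp.2
      simp only [gadgetNetwork] at h1 h2
      split_ifs at h1 h2 <;> omega
    | ⟨⟨j, hj⟩, c⟩ :: ⟨⟨j', hj'⟩, c'⟩ :: p, ⟨h1, h2, h3⟩ =>
      have h1' := congrArg Fin.val h1
      have h2' := congrArg Fin.val h2
      simp only [gadgetNetwork] at h1' h2'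
      have hc : c ≠ 2 := by
        intro hc
        rw [if_pos hc] at h1'
        omega
      rw [if_neg hc] at h1' h2'
      have hc' : c' = 2 := by
        by_contra hc'
        rw [if_neg hc'] at h2'
        omega
      rw [if_pos hc'] at h2'
      obtain rfl : j = i := by omega
      obtain rfl : j' = j := by omega
      subst hc'
      obtain ⟨b, rfl⟩ := ih (j' + 1) (by omega) p (by
        convert h3 using 1
        exact Fin.ext (by simp [gadgetNetwork]; omega))
      refine ⟨Function.update b j' (decide (c = 1)), ?_⟩
      rw [gadgetWalk, Function.update_self,
        gadgetWalk_congr (b := Function.update b j' _) (b' := b) n (j' + 1) _ fun l hl _ =>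
          Function.update_of_ne (show l ≠ j' by omega) _ _]
      congr
      fin_cases c <;> simp [lane] at hc ⊢

theorem exists_eq_gadgetPath (P : (gadgetNetwork k hk).Path) : ∃ b, P = gadgetPath k hk b := by
  obtain ⟨b, hb⟩ := exists_eq_gadgetWalk k 0 (zero_add k) P.1 P.2.1
  exact ⟨b, Subtype.ext hb⟩

theorem isSPBetween_gadget (i : ℕ) (hi : i < k) :
    IsSPBetween (gadgetNetwork k hk).tail (gadgetNetwork k hk).head
      ⟨2 * i, by omega⟩ ⟨2 * i + 2, by omega⟩
      {v | 2 * i ≤ v.1 ∧ v.1 ≤ 2 * i + 2} {e | e.1.1 = i} := by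
  have edge : ∀ c : Fin 3, c ≠ 2 → IsSPBetween (gadgetNetwork k hk).tail (gadgetNetwork k hk).head
      ⟨2 * i, by omega⟩ ⟨2 * i + 1, by omega⟩ {⟨2 * i, by omega⟩, ⟨2 * i + 1, by omega⟩}
      {(⟨i, hi⟩, c)} := by
    intro c hc
    convert IsSPBetween.edge (tail := (gadgetNetwork k hk).tail)
      (head := (gadgetNetwork k hk).head) (⟨i, hi⟩, c) ?_ using 1 <;> simp [gadgetNetwork, hc]
  have last : IsSPBetween (gadgetNetwork k hk).tail (gadgetNetwork k hk).head
      ⟨2 * i + 1, by omega⟩ ⟨2 * i + 2, by omega⟩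
      {⟨2 * i + 1, by omega⟩, ⟨2 * i + 2, by omega⟩} {(⟨i, hi⟩, 2)} := by
    convert IsSPBetween.edge (tail := (gadgetNetwork k hk).tail)
      (head := (gadgetNetwork k hk).head) (⟨i, hi⟩, 2) ?_ using 1 <;> simp [gadgetNetwork]
  have h := ((edge 0 (by decide)).parallel (edge 1 (by decide)) (by simp) (by simp)).series last
    (by ext v; simp [Fin.ext_iff]; omega) (by simp)
  convert h using 1
  · ext v
    simp [Fin.ext_iff]
    omega
  · ext ⟨j, c⟩
    fin_cases c <;> simp [Fin.ext_iff]

theorem isSPBetween_initial (n : ℕ) (hn : n < k) :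
    IsSPBetween (gadgetNetwork k hk).tail (gadgetNetwork k hk).head
      ⟨0, by omega⟩ ⟨2 * n + 2, by omega⟩ {v | v.1 ≤ 2 * n + 2} {e | e.1.1 ≤ n} := by
  induction n with
  | zero =>
    convert isSPBetween_gadget (hk := hk) 0 hk using 1
    · ext v; simp
    · ext e; simp
  | succ n ih =>
    convert (ih (by omega)).series (isSPBetween_gadget (hk := hk) (n + 1) hn) ?_ ?_ using 1
    · ext v
      simp
      omega
    · ext e
      simp
      omega
    · ext v
      simp [Fin.ext_iff]
      omega
    · rw [Set.disjoint_left]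
      intro e h1 h2
      simp only [Set.mem_ofPred_eq] at h1 h2
      omega

theorem isSeriesParallel_gadgetNetwork : (gadgetNetwork k hk).IsSeriesParallel := by
  have h := isSPBetween_initial (hk := hk) (k - 1) (by omega)
  have h1 : {v : Fin (2 * k + 1) | v.1 ≤ 2 * (k - 1) + 2} = Set.univ :=
    Set.eq_univ_of_forall fun v => show v.1 ≤ 2 * (k - 1) + 2 by omega
  have h2 : {e : Fin k × Fin 3 | e.1.1 ≤ k - 1} = Set.univ :=
    Set.eq_univ_of_forall fun e => show e.1.1 ≤ k - 1 by omega
  have h3 : (⟨2 * (k - 1) + 2, by omega⟩ : Fin (2 * k + 1)) = (gadgetNetwork k hk).t :=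
    Fin.ext (show 2 * (k - 1) + 2 = 2 * k by omega)
  rw [h1, h2, h3] at h
  exact h

end Gadgets

/-! ### The doubling map and its invariant measure. -/

section LowerFlow

/-- The doubling map on `[0, 2)`, extended by the identity on `[2, ∞)`. -/
def doubling (w : ℝ) : ℝ := if w < 1 then 2 * w else w - 1 + min (w - 1) 1

theorem doubling_of_lt {w : ℝ} (h : w < 1) : doubling w = 2 * w := if_pos h

theorem doubling_of_le {w : ℝ} (h : 1 ≤ w) : doubling w = w - 1 + min (w - 1) 1 :=
  if_neg (not_lt.2 h)

theorem doubling_of_mem {w : ℝ} (h : 1 ≤ w) (h' : w < 2) : doubling w = 2 * w - 2 := by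
  rw [doubling_of_le h, min_eq_left (by linarith)]
  ring

theorem doubling_of_two_le {w : ℝ} (h : 2 ≤ w) : doubling w = w := by
  rw [doubling_of_le (by linarith), min_eq_right (by linarith)]
  ring

theorem doubling_nonneg {w : ℝ} (h : 0 ≤ w) : 0 ≤ doubling w := by
  rcases lt_or_ge w 1 with h1 | h1
  · rw [doubling_of_lt h1]
    linarith
  · rw [doubling_of_le h1]
    exact add_nonneg (by linarith) (le_min (by linarith) zero_le_one)

theorem doubling_lt_two_iff {w : ℝ} : doubling w < 2 ↔ w < 2 := by
  rcases lt_or_ge w 1 with h1 | h1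
  · rw [doubling_of_lt h1]
    constructor <;> intro <;> linarith
  · rcases lt_or_ge w 2 with h2 | h2
    · rw [doubling_of_mem h1 h2]
      constructor <;> intro <;> linarith
    · rw [doubling_of_two_le h2]

theorem iterate_doubling_nonneg {w : ℝ} (h : 0 ≤ w) (i : ℕ) : 0 ≤ doubling^[i] w := by
  induction i with
  | zero => exact h
  | succ i ih =>
    rw [Function.iterate_succ_apply']
    exact doubling_nonneg ih

theorem iterate_doubling_lt_two_iff {w : ℝ} (i : ℕ) : doubling^[i] w < 2 ↔ w < 2 := by
  induction i with
  | zero => exact Iff.rfl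
  | succ i ih => rw [Function.iterate_succ_apply', doubling_lt_two_iff, ih]

theorem iterate_doubling_of_two_le {w : ℝ} (h : 2 ≤ w) (i : ℕ) : doubling^[i] w = w :=
  Function.iterate_fixed (doubling_of_two_le h) i

theorem measurable_doubling : Measurable doubling :=
  Measurable.ite measurableSet_Iio (by fun_prop) (by fun_prop)

/-- Each of the two branches on `[0, 1)` and `[1, 2)` stretches by 2 onto `[0, 2)`, so a set in `[0,
2)` has two preimages of half its measure; beyond 2 the map is the identity. -/
theorem measurePreserving_doubling :
    MeasurePreserving doubling (volume.restrict (Set.Ici 0)) (volume.restrict (Set.Ici 0)) := by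
  refine ⟨measurable_doubling, ?_⟩
  ext A hA
  rw [Measure.map_apply measurable_doubling hA,
    Measure.restrict_apply (measurable_doubling hA), Measure.restrict_apply hA]
  -- The preimage of `C` under the second branch is the translate by 1 of that under the first.
  set C : Set ℝ := A ∩ Set.Ico 0 2
  have hC : MeasurableSet C := hA.inter measurableSet_Ico
  have hC0 : MeasurableSet ((fun w : ℝ => 2 * w) ⁻¹' C) := (measurable_const_mul 2) hC
  have hC1 : MeasurableSet ((fun w : ℝ => w + -1) ⁻¹' ((fun w : ℝ => 2 * w) ⁻¹' C)) :=
    (measurable_add_const (-1)) hC0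
  have hA2 : MeasurableSet (A ∩ Set.Ici 2) := hA.inter measurableSet_Ici
  have h1 : doubling ⁻¹' A ∩ Set.Ici 0 = ((fun w : ℝ => 2 * w) ⁻¹' C ∪
      (fun w : ℝ => w + -1) ⁻¹' ((fun w : ℝ => 2 * w) ⁻¹' C)) ∪ (A ∩ Set.Ici 2) := by
    ext w
    simp only [C, Set.mem_inter_iff, Set.mem_preimage, Set.mem_union, Set.mem_Ici, Set.mem_Ico]
    rcases lt_or_ge w 1 with h1 | h1
    · rw [doubling_of_lt h1]
      constructor
      · rintro ⟨h2, h3⟩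
        exact Or.inl (Or.inl ⟨h2, by linarith, by linarith⟩)
      · rintro ((⟨h2, h3, -⟩ | ⟨-, h3, -⟩) | ⟨-, h3⟩)
        · exact ⟨h2, by linarith⟩
        · linarith
        · linarith
    · rcases lt_or_ge w 2 with h2 | h2
      · rw [doubling_of_mem h1 h2, show 2 * w - 2 = 2 * (w + -1) by ring]
        constructor
        · rintro ⟨h3, h4⟩
          exact Or.inl (Or.inr ⟨h3, by linarith, by linarith⟩)
        · rintro ((⟨-, -, h3⟩ | ⟨h3, -, -⟩) | ⟨-, h3⟩)
          · linarith
          · exact ⟨h3, by linarith⟩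
          · linarith
      · rw [doubling_of_two_le h2]
        constructor
        · rintro ⟨h3, h4⟩
          exact Or.inr ⟨h3, h2⟩
        · rintro ((⟨-, -, h3⟩ | ⟨-, -, h3⟩) | ⟨h3, -⟩)
          · linarith
          · linarith
          · exact ⟨h3, by linarith⟩
  have h2 : A ∩ Set.Ici 0 = C ∪ (A ∩ Set.Ici 2) := by
    rw [← Set.inter_union_distrib_left, Set.Ico_union_Ici_eq_Ici zero_le_two]
  rw [h1, h2, measure_union ?_ hA2, measure_union ?_ hC1, measure_union ?_ hA2,
    measure_preimage_add_right, Real.volume_preimage_mul_left two_ne_zero, ← two_mul, ← mul_assoc]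
  · congr 1
    rw [← ENNReal.ofReal_ofNat 2, ← ENNReal.ofReal_mul zero_le_two]
    norm_num
  · rw [Set.disjoint_left]
    rintro w ⟨-, -, h⟩ ⟨-, h'⟩
    exact absurd h (not_lt.2 h')
  · rw [Set.disjoint_left]
    rintro w ⟨-, -, h⟩ ⟨-, h', -⟩
    simp only at h h'
    linarith
  · rw [Set.disjoint_left]
    rintro w (⟨-, -, h⟩ | ⟨-, -, h⟩) ⟨-, h' : 2 ≤ w⟩
    · linarith
    · linarith

/-- Lets the flow entering gadget `i` be measured by shifted entry time instead of departure time.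
-/
theorem volume_iterate_doubling (i : ℕ) {S : Set ℝ} (hS : MeasurableSet S) :
    volume.real {θ | 0 ≤ θ ∧ doubling^[i] θ ∈ S} = volume.real (S ∩ Set.Ici 0) := by
  have h := (measurePreserving_doubling.iterate i).measure_preimage hS.nullMeasurableSet
  rw [Measure.restrict_apply ((measurable_doubling.iterate i) hS), Measure.restrict_apply hS] at h
  rw [measureReal_def, measureReal_def, ← h]
  congr 2
  ext θ
  exact and_comm

/-- Whether a particle that leaves the source at time `θ` takes the lower edge of gadget `i` in the
Nash flow. -/
def nashChoice (θ : ℝ) (i : ℕ) : Bool := decide (1 ≤ doubling^[i] θ)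

/-- The path depends only on the first `k` choices, so the map factors measurably through the finite
space `Fin k → Bool`. -/
theorem measurableSet_gadgetPath_nashChoice {k : ℕ} {hk : 0 < k} (P : (gadgetNetwork k hk).Path) :
    MeasurableSet ((fun θ => gadgetPath k hk (nashChoice θ)) ⁻¹' {P}) := by
  have h1 : (fun θ => gadgetPath k hk (nashChoice θ)) =
      (fun a : Fin k → Bool => gadgetPath k hk fun i => if h : i < k then a ⟨i, h⟩ else false) ∘
        fun θ i => nashChoice θ i := by
    ext1 θ
    refine Subtype.ext (gadgetWalk_congr k 0 (zero_add k) fun j _ hj => ?_)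
    rw [dif_pos hj]
  have h2 : Measurable fun (θ : ℝ) (i : Fin k) => nashChoice θ i := by
    refine measurable_pi_lambda _ fun i => measurable_to_bool ?_
    have : (fun θ => nashChoice θ i) ⁻¹' {true} = doubling^[(i : ℕ)] ⁻¹' Set.Ici 1 := by
      ext θ
      simp [nashChoice]
    rw [this]
    exact (measurable_doubling.iterate _) measurableSet_Ici
  rw [h1, Set.preimage_comp]
  exact h2 (Set.toFinite _).measurableSet

theorem sum_indicator_preimage_singleton {ι : Type} [Fintype ι] (p : ℝ → ι) (θ : ℝ) :
    ∑ i, (p ⁻¹' {i}).indicator (1 : ℝ → ℝ) θ = 1 := by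
  rw [Finset.sum_eq_single (p θ)]
  · exact Set.indicator_of_mem (s := p ⁻¹' {p θ}) rfl _
  · exact fun i _ hi => Set.indicator_of_notMem (fun h => hi h.symm) _
  · exact fun h => absurd (Finset.mem_univ _) h

theorem FlowOverTime.amountBefore_of_indicator {V E : Type} [Fintype E] {N : Network V E}
    (f : FlowOverTime N) (p : ℝ → N.Path) (hf : ∀ P, f.pathRate P = (p ⁻¹' {P}).indicator 1)
    (T : ℝ) :
    f.amountBefore T = volume.real {θ | 0 ≤ θ ∧ N.arrivalTime f.queue (p θ) θ < T} := by
  have hp : ∀ P, MeasurableSet (p ⁻¹' {P}) := by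
    intro P
    have h := f.measurable_pathRate P
    rw [hf P] at h
    exact (measurable_indicator_const_iff 1).1 h
  have hB : {θ | 0 ≤ θ ∧ N.arrivalTime f.queue (p θ) θ < T} ⊆ Set.Icc 0 T :=
    fun θ hθ => ⟨hθ.1, ((N.le_traverse f.queue_nonneg _ θ).trans_lt hθ.2).le⟩
  have h := sum_integral_indicator p hp Finset.univ
    (fun P => {θ : ℝ | 0 ≤ θ ∧ N.arrivalTime f.queue P θ < T})
    {θ | 0 ≤ θ ∧ N.arrivalTime f.queue (p θ) θ < T}
    (measure_ne_top_of_subset hB (by rw [Real.volume_Icc]; exact ENNReal.ofReal_ne_top))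
    fun θ _ => Iff.rfl
  simp only [Finset.mem_univ, true_and] at h
  rw [FlowOverTime.amountBefore]
  simp only [hf]
  exact h

open scoped Classical in
theorem sum_integral_entryTime {V E : Type} [Fintype E] {N : Network V E} (p : ℝ → N.Path)
    (hp : ∀ P, MeasurableSet (p ⁻¹' {P})) (z : E → ℝ → ℝ) (e : E) (x : ℝ) {B : Set ℝ}
    (hB : B ⊆ Set.Icc 0 x)
    (h : ∀ θ, e ∈ (p θ).edges → (0 ≤ θ ∧ N.entryTime z (p θ) e θ ≤ x ↔ θ ∈ B)) :
    ∑ P with e ∈ P.edges, ∫ ξ in {ξ : ℝ | 0 ≤ ξ ∧ N.entryTime z P e ξ ≤ x},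
      (p ⁻¹' {P}).indicator 1 ξ = volume.real {θ | e ∈ (p θ).edges ∧ θ ∈ B} := by
  rw [sum_integral_indicator p hp _ (fun P => {ξ : ℝ | 0 ≤ ξ ∧ N.entryTime z P e ξ ≤ x}) B
    (measure_ne_top_of_subset hB (by rw [Real.volume_Icc]; exact ENNReal.ofReal_ne_top))
    fun θ hθ => h θ (Finset.mem_filter.1 hθ).2]
  simp only [Finset.mem_filter, Finset.mem_univ, true_and]

/-! ### The all-lower flow and the positivity of the worst Nash amount. -/

theorem traverse_zero {k : ℕ} {hk : 0 < k} (p : List (Fin k × Fin 3)) (hp : ∀ e ∈ p, e.2 ≠ 0)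
    (θ : ℝ) : (gadgetNetwork k hk).traverse (fun _ _ => 0) p θ = θ := by
  induction p with
  | nil => rfl
  | cons e p ih =>
    rw [Network.traverse, Network.exitTime]
    simpa [gadgetNetwork, hp e (by simp)] using ih fun e he => hp e (by simp [he])

theorem snd_ne_zero_of_mem_lowerPath {k : ℕ} {hk : 0 < k} (e : Fin k × Fin 3)
    (he : e ∈ (gadgetPath k hk fun _ => true).edges) : e.2 ≠ 0 := by
  obtain ⟨j, c⟩ := e
  obtain ⟨-, rfl | rfl⟩ := (mem_gadgetWalk k 0 (zero_add k) j c).1 he <;> simp [lane]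

/-- The flow over time in which all particles take all the lower edges. -/
def lowerFlow (k : ℕ) (hk : 0 < k) : FlowOverTime (gadgetNetwork k hk) where
  pathRate P := ((fun _ => gadgetPath k hk fun _ => true) ⁻¹' {P}).indicator 1
  edgeRate e _ := if e.2 = 0 then 0 else 1
  queue _ _ := 0
  measurable_pathRate P := measurable_one.indicator (MeasurableSet.const _)
  pathRate_nonneg P := Set.indicator_nonneg fun _ _ => zero_le_one
  sum_pathRate θ _ := sum_indicator_preimage_singleton _ θ
  edgeRate_nonneg e _ := by split <;> norm_num
  edgeRate_integrable e x _ := intervalIntegrable_const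
  queue_nonneg _ _ := le_rfl
  queue_continuousOn _ := continuousOn_const
  queue_dynamics e x _ := by
    simp only [lt_irrefl, if_false]
    split_ifs <;> simp [gadgetNetwork]
  loading e x hx := by
    obtain ⟨j, c⟩ := e
    rw [sum_integral_entryTime (fun _ : ℝ => gadgetPath k hk fun _ => true)
      (fun P => MeasurableSet.const _) _ _ x (subset_refl (Set.Icc 0 x)) ?_]
    · simp only [edges_gadgetPath, mem_gadgetWalk, zero_le, intervalIntegral.integral_const]
      by_cases hc : c = 0
      · simp [hc, lane]
      · have : c = lane true ∨ c = 2 := by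
          fin_cases c <;> simp [lane] at hc ⊢
        rw [if_neg hc]
        have h : {θ : ℝ | 0 ≤ θ ∧ θ ≤ x} = Set.Icc 0 x := rfl
        simp [this, h, hx]
    · intro θ _
      rw [Network.entryTime, traverse_zero _ fun e he => snd_ne_zero_of_mem_lowerPath _
        (List.takeWhile_subset _ he)]
      exact Iff.rfl

theorem amountBefore_lowerFlow (k : ℕ) (hk : 0 < k) {T : ℝ} (hT : 0 ≤ T) :
    (lowerFlow k hk).amountBefore T = T := by
  rw [(lowerFlow k hk).amountBefore_of_indicator _ fun P => rfl]
  have h : {θ : ℝ | 0 ≤ θ ∧ (gadgetNetwork k hk).arrivalTime (lowerFlow k hk).queue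
      (gadgetPath k hk fun _ => true) θ < T} = Set.Ico 0 T := by
    ext θ
    rw [Set.mem_ofPred_eq, Network.arrivalTime]
    change 0 ≤ θ ∧ (gadgetNetwork k hk).traverse (fun _ _ => 0) _ θ < T ↔ _
    rw [traverse_zero _ fun e he => snd_ne_zero_of_mem_lowerPath _ he]
    exact Iff.rfl
  rw [h, Real.volume_real_Ico_of_le hT, sub_zero]

variable {k : ℕ} {hk : 0 < k}

theorem le_optAmount : ENNReal.ofReal (k + 2) ≤ (gadgetNetwork k hk).optAmount := by
  refine le_iSup_of_le (lowerFlow k hk) (ENNReal.ofReal_le_ofReal ?_)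
  exact (amountBefore_lowerFlow k hk (by positivity)).ge

theorem quickestTime_le_two {M : ℝ≥0∞} (hM : M ≤ 2) : (gadgetNetwork k hk).quickestTime M ≤ 2 := by
  refine iInf_le_of_le 2 (iInf_le_of_le zero_le_two (iInf_le_of_le ⟨lowerFlow k hk, ?_⟩ ?_))
  · rw [amountBefore_lowerFlow k hk zero_le_two]
    simpa using hM
  · simp

/-- The waiting time on an edge is at most the entry time (`queue_le` with unit inflow and
capacity), so each edge without transit time at most doubles the clock; a gadget has two such edges
on its lower route. -/
theorem FlowOverTime.traverse_lower_le (f : FlowOverTime (gadgetNetwork k hk)) (n i : ℕ)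
    (h : i + n = k) {y : ℝ} (hy : 0 ≤ y) :
    (gadgetNetwork k hk).traverse f.queue (gadgetWalk k (fun _ => true) n i h) y ≤ 4 ^ n * y := by
  have hstep : ∀ (e : Fin k × Fin 3), e.2 ≠ 0 → ∀ x, 0 ≤ x →
      (gadgetNetwork k hk).exitTime f.queue e x ≤ 2 * x := by
    intro e he x hx
    have h1 := f.queue_le e hx
    have h2 : (gadgetNetwork k hk).exitTime f.queue e x = x + f.queue e x / 1 + 0 := by
      rw [Network.exitTime]
      simp [gadgetNetwork, he]
    have h3 : (gadgetNetwork k hk).u = 1 := rfl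
    rw [h3] at h1
    rw [h2]
    linarith
  induction n generalizing i y with
  | zero => simp [gadgetWalk, Network.traverse]
  | succ n ih =>
    rw [gadgetWalk, Network.traverse, Network.traverse]
    have h1 := hstep (⟨i, by omega⟩, lane true) (by simp [lane]) y hy
    have h1' := hy.trans ((gadgetNetwork k hk).le_exitTime f.queue_nonneg (⟨i, by omega⟩, lane true) y)
    have h2 := hstep (⟨i, by omega⟩, 2) (by simp) _ h1'
    have h2' := h1'.trans ((gadgetNetwork k hk).le_exitTime f.queue_nonneg (⟨i, by omega⟩, 2) _)
    refine (ih (i + 1) (by omega) h2').trans ?_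
    rw [pow_succ, mul_assoc]
    gcongr
    linarith

theorem worstNashAmount_pos : 0 < (gadgetNetwork k hk).worstNashAmount := by
  have hε : (0 : ℝ) < (4 ^ k)⁻¹ := by positivity
  refine (ENNReal.ofReal_pos.2 hε).trans_le
    (le_iInf₂ fun f hf => ENNReal.ofReal_le_ofReal ?_)
  rw [← mul_one (4 ^ k : ℝ)⁻¹]
  refine hf.le_amount hε.le (gadgetPath k hk fun _ => true) fun θ h0 h1 => ?_
  refine (f.traverse_lower_le k 0 (zero_add k) h0).trans_lt ?_
  have h2 : (4 : ℝ) ^ k * θ < 1 := by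
    rwa [← lt_div_iff₀' (by positivity), one_div]
  have h3 : (gadgetNetwork k hk).D = k + 2 := rfl
  rw [h3]
  have : (0 : ℝ) ≤ k := k.cast_nonneg
  linarith

end LowerFlow

/-! ### Queues, travel times and loading of the Nash flow. -/

section NashFlow

variable {k : ℕ} {hk : 0 < k}

/-- The queues of the Nash flow: only the last edges of the gadgets have one. -/
def nashQueue (k : ℕ) (e : Fin k × Fin 3) (y : ℝ) : ℝ :=
  if e.2 = 2 then max (min (y - (e.1 + 1)) 1) 0 else 0

theorem nashQueue_nonneg (e : Fin k × Fin 3) (y : ℝ) : 0 ≤ nashQueue k e y := by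
  rw [nashQueue]
  split_ifs
  · exact le_max_right _ _
  · exact le_rfl

/-- The edge inflow rates of the Nash flow. -/
def nashRate (k : ℕ) (e : Fin k × Fin 3) : ℝ → ℝ :=
  if e.2 = 0 then (Set.Ico (e.1 : ℝ) (e.1 + 1)).indicator 1
  else if e.2 = 1 then (Set.Ici ((e.1 : ℝ) + 1)).indicator 1
  else (Set.Ico ((e.1 : ℝ) + 1) (e.1 + 2)).indicator 1 + (Set.Ici ((e.1 : ℝ) + 1)).indicator 1

theorem exitTime_upper (i : Fin k) (y : ℝ) :
    (gadgetNetwork k hk).exitTime (nashQueue k) (i, lane false) y = y + 1 := by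
  simp [Network.exitTime, gadgetNetwork, nashQueue, lane]

theorem exitTime_lower (i : Fin k) (y : ℝ) :
    (gadgetNetwork k hk).exitTime (nashQueue k) (i, lane true) y = y := by
  simp [Network.exitTime, gadgetNetwork, nashQueue, lane]

theorem exitTime_last (i : Fin k) (y : ℝ) :
    (gadgetNetwork k hk).exitTime (nashQueue k) (i, 2) y =
      y + max (min (y - (i + 1)) 1) 0 := by
  simp [Network.exitTime, gadgetNetwork, nashQueue]

/-- The queue met at the last edge is `w` after the upper edge and `min (w - 1) 1` after the lower
one, which yields exactly the doubling map. -/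
theorem exitTime_gadget (i : ℕ) (hi : i < k) {w : ℝ} (hw : 0 ≤ w) :
    (gadgetNetwork k hk).exitTime (nashQueue k) (⟨i, hi⟩, 2)
      ((gadgetNetwork k hk).exitTime (nashQueue k) (⟨i, hi⟩, lane (decide (1 ≤ w))) (i + w)) =
      ((i + 1 : ℕ) : ℝ) + doubling w := by
  rcases lt_or_ge w 1 with h | h
  · rw [decide_eq_false (not_le.2 h), exitTime_upper, exitTime_last, doubling_of_lt h,
      min_eq_left (by linarith), max_eq_left (by linarith)]
    push_cast
    ring
  · rw [decide_eq_true h, exitTime_lower, exitTime_last, doubling_of_le h,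
      show (i : ℝ) + w - (i + 1) = w - 1 by ring,
      max_eq_left (le_min (by linarith) zero_le_one)]
    push_cast
    ring

theorem exitTime_nashChoice {θ : ℝ} (hθ : 0 ≤ θ) (i : ℕ) (hi : i < k) :
    (gadgetNetwork k hk).exitTime (nashQueue k) (⟨i, hi⟩, 2)
      ((gadgetNetwork k hk).exitTime (nashQueue k) (⟨i, hi⟩, lane (nashChoice θ i))
        (i + doubling^[i] θ)) = ((i + 1 : ℕ) : ℝ) + doubling^[i + 1] θ := by
  rw [nashChoice, exitTime_gadget i hi (iterate_doubling_nonneg hθ i),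
    ← Function.iterate_succ_apply' doubling]

theorem traverse_nash {θ : ℝ} (hθ : 0 ≤ θ) (n i : ℕ) (h : i + n = k) :
    (gadgetNetwork k hk).traverse (nashQueue k) (gadgetWalk k (nashChoice θ) n i h)
      (i + doubling^[i] θ) = k + doubling^[k] θ := by
  induction n generalizing i with
  | zero =>
    obtain rfl : i = k := by omega
    rfl
  | succ n ih =>
    rw [gadgetWalk, Network.traverse, Network.traverse, exitTime_nashChoice hθ]
    exact ih (i + 1) (by omega)

theorem arrivalTime_nash {θ : ℝ} (hθ : 0 ≤ θ) :
    (gadgetNetwork k hk).arrivalTime (nashQueue k) (gadgetPath k hk (nashChoice θ)) θ =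
      k + doubling^[k] θ := by
  rw [← traverse_nash (hk := hk) hθ k 0 (zero_add k), Network.arrivalTime, edges_gadgetPath]
  simp

theorem traverse_takeWhile_lane {θ : ℝ} (hθ : 0 ≤ θ) (j : Fin k) (n i : ℕ) (h : i + n = k)
    (hij : i ≤ j) :
    (gadgetNetwork k hk).traverse (nashQueue k) ((gadgetWalk k (nashChoice θ) n i h).takeWhile
      fun e => decide (e ≠ (j, lane (nashChoice θ j)))) (i + doubling^[i] θ) =
      j + doubling^[j] θ := by
  induction n generalizing i with
  | zero => omega
  | succ n ih =>
    obtain ⟨j, hj⟩ := j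
    rcases hij.eq_or_lt with rfl | hij
    · simp [gadgetWalk, Network.traverse]
    · simp only at hij
      rw [gadgetWalk, List.takeWhile_cons_of_pos (by simp [hij.ne]),
        List.takeWhile_cons_of_pos (by simp [hij.ne]), Network.traverse, Network.traverse,
        exitTime_nashChoice hθ]
      exact ih (i + 1) (by omega) hij

theorem traverse_takeWhile_last {θ : ℝ} (hθ : 0 ≤ θ) (j : Fin k) (n i : ℕ) (h : i + n = k)
    (hij : i ≤ j) :
    (gadgetNetwork k hk).traverse (nashQueue k) ((gadgetWalk k (nashChoice θ) n i h).takeWhile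
      fun e => decide (e ≠ (j, 2))) (i + doubling^[i] θ) =
      (gadgetNetwork k hk).exitTime (nashQueue k) (j, lane (nashChoice θ j))
        (j + doubling^[j] θ) := by
  induction n generalizing i with
  | zero => omega
  | succ n ih =>
    obtain ⟨j, hj⟩ := j
    rcases hij.eq_or_lt with rfl | hij
    · have : lane (nashChoice θ i) ≠ 2 := by
        cases nashChoice θ i <;> simp [lane]
      simp [gadgetWalk, Network.traverse, this]
    · simp only at hij
      rw [gadgetWalk, List.takeWhile_cons_of_pos (by simp [hij.ne]),
        List.takeWhile_cons_of_pos (by simp [hij.ne]), Network.traverse, Network.traverse,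
        exitTime_nashChoice hθ]
      exact ih (i + 1) (by omega) hij

theorem entryTime_lane {θ : ℝ} (hθ : 0 ≤ θ) (j : Fin k) (c : Fin 3)
    (hc : c = lane (nashChoice θ j)) :
    (gadgetNetwork k hk).entryTime (nashQueue k) (gadgetPath k hk (nashChoice θ)) (j, c) θ =
      j + doubling^[j] θ := by
  subst hc
  rw [← traverse_takeWhile_lane (hk := hk) hθ j k 0 (zero_add k) (Nat.zero_le _),
    Network.entryTime, edges_gadgetPath]
  simp

theorem entryTime_last {θ : ℝ} (hθ : 0 ≤ θ) (j : Fin k) :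
    (gadgetNetwork k hk).entryTime (nashQueue k) (gadgetPath k hk (nashChoice θ)) (j, 2) θ =
      if doubling^[j] θ < 1 then j + doubling^[j] θ + 1 else j + doubling^[j] θ := by
  have h := traverse_takeWhile_last (hk := hk) hθ j k 0 (zero_add k) (Nat.zero_le _)
  rw [Nat.cast_zero, zero_add, Function.iterate_zero, id] at h
  rw [Network.entryTime, edges_gadgetPath]
  refine Eq.trans (by congr!) (h.trans ?_)
  rw [nashChoice]
  split_ifs with h1
  · rw [decide_eq_false (not_le.2 h1), exitTime_upper]
  · rw [decide_eq_true (not_lt.1 h1), exitTime_lower]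

theorem integral_nashRate {x : ℝ} (hx : 0 ≤ x) (e : Fin k × Fin 3) :
    ∫ y in (0 : ℝ)..x, nashRate k e y =
      if e.2 = 0 then volume.real (Set.Ico (e.1 : ℝ) (e.1 + 1) ∩ Set.Iic x)
      else if e.2 = 1 then volume.real (Set.Ici ((e.1 : ℝ) + 1) ∩ Set.Iic x)
      else volume.real (Set.Ico ((e.1 : ℝ) + 1) (e.1 + 2) ∩ Set.Iic x) +
        volume.real (Set.Ici ((e.1 : ℝ) + 1) ∩ Set.Iic x) := by
  have h0 : (0 : ℝ) ≤ (e.1 : ℕ) := Nat.cast_nonneg _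
  have h1 := intervalIntegral_indicator_one (measurableSet_Ico (a := (e.1 : ℝ)) (b := e.1 + 1))
    (fun y hy => h0.trans hy.1) hx
  have h2 := intervalIntegral_indicator_one (measurableSet_Ici (a := (e.1 : ℝ) + 1))
    (fun y (hy : (e.1 : ℝ) + 1 ≤ y) => show 0 ≤ y by linarith) hx
  have h3 := intervalIntegral_indicator_one (measurableSet_Ico (a := (e.1 : ℝ) + 1) (b := e.1 + 2))
    (fun y hy => show 0 ≤ y by linarith [hy.1]) hx
  rw [nashRate]
  split_ifs
  · exact h1
  · exact h2
  · rw [← h2, ← h3]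
    exact intervalIntegral.integral_add (intervalIntegrable_indicator_one measurableSet_Ico _ _)
      (intervalIntegrable_indicator_one measurableSet_Ici _ _)

/-- The amount that enters a gadget with shifted entry times in `[0, ∞) ∩ S`. -/
theorem volume_shift (i : ℕ) (a x : ℝ) {S : Set ℝ} (hS : MeasurableSet S)
    (hS0 : S ⊆ Set.Ici 0) :
    volume.real {θ | 0 ≤ θ ∧ doubling^[i] θ ∈ S ∧ a + doubling^[i] θ ≤ x} =
      volume.real ({y | y - a ∈ S} ∩ Set.Iic x) := by
  have hm : MeasurableSet {y | y - a ∈ S} := (measurable_sub_const a) hS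
  have hm' : MeasurableSet ((fun w => a + w) ⁻¹' ({y | y - a ∈ S} ∩ Set.Iic x)) :=
    (measurable_const_add a) (hm.inter measurableSet_Iic)
  have h := volume_iterate_doubling i hm'
  have h1 : (fun w => a + w) ⁻¹' ({y | y - a ∈ S} ∩ Set.Iic x) ∩ Set.Ici 0 =
      (fun w => a + w) ⁻¹' ({y | y - a ∈ S} ∩ Set.Iic x) :=
    Set.inter_eq_left.2 fun w hw => hS0 (by simpa using hw.1)
  rw [h1, measureReal_def, measureReal_def, measure_preimage_add] at h
  rw [measureReal_def, measureReal_def, ← h]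
  congr 2
  ext θ
  simp [le_sub_iff_add_le']

/-- Since the doubling map fixes all times from 2 on, a bound on the iterate bounds `θ`. -/
theorem volume_shift_ne_top (i : ℕ) (a x : ℝ) (S : Set ℝ) :
    volume {θ | 0 ≤ θ ∧ doubling^[i] θ ∈ S ∧ a + doubling^[i] θ ≤ x} ≠ ∞ := by
  suffices hs : {θ | 0 ≤ θ ∧ doubling^[i] θ ∈ S ∧ a + doubling^[i] θ ≤ x} ⊆
      Set.Icc 0 (max 2 (x - a)) from
    measure_ne_top_of_subset hs (by rw [Real.volume_Icc]; exact ENNReal.ofReal_ne_top)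
  rintro θ ⟨h0, -, h⟩
  refine ⟨h0, ?_⟩
  rcases le_total θ 2 with h2 | h2
  · exact le_max_of_le_left h2
  · rw [iterate_doubling_of_two_le h2] at h
    exact le_max_of_le_right (by linarith)

/-- By invariance the shifted entry times into gadget `j` are distributed by Lebesgue measure on
`[0, ∞)`. The upper edge receives those in `[0, 1)`, the lower edge those in `[1, ∞)`, and the last
edge both, the former delayed by 1. -/
theorem loading_nash (e : Fin k × Fin 3) {x : ℝ} (hx : 0 ≤ x) :
    ∫ y in (0 : ℝ)..x, nashRate k e y = volume.real
      {θ | e ∈ (gadgetPath k hk (nashChoice θ)).edges ∧ 0 ≤ θ ∧ (gadgetNetwork k hk).entryTime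
        (nashQueue k) (gadgetPath k hk (nashChoice θ)) e θ ≤ x} := by
  obtain ⟨j, c⟩ := e
  have hup : {y : ℝ | y - j ∈ Set.Ico (0 : ℝ) 1} = Set.Ico (j : ℝ) (j + 1) := by
    ext y
    simp only [Set.mem_ofPred_eq, Set.mem_Ico]
    constructor <;> rintro ⟨h1, h2⟩ <;> constructor <;> linarith
  have hup' : {y : ℝ | y - (j + 1) ∈ Set.Ico (0 : ℝ) 1} = Set.Ico ((j : ℝ) + 1) (j + 2) := by
    ext y
    simp only [Set.mem_ofPred_eq, Set.mem_Ico]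
    constructor <;> rintro ⟨h1, h2⟩ <;> constructor <;> linarith
  have hlow : {y : ℝ | y - j ∈ Set.Ici (1 : ℝ)} = Set.Ici ((j : ℝ) + 1) := by
    ext y
    simp only [Set.mem_ofPred_eq, Set.mem_Ici]
    constructor <;> intro h <;> linarith
  have key1 := volume_shift j j x (measurableSet_Ico (a := (0 : ℝ)) (b := 1))
    Set.Ico_subset_Ici_self
  have key2 := volume_shift j j x (measurableSet_Ici (a := (1 : ℝ)))
    (Set.Ici_subset_Ici.2 zero_le_one)
  have key3 := volume_shift j (j + 1) x (measurableSet_Ico (a := (0 : ℝ)) (b := 1))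
    Set.Ico_subset_Ici_self
  rw [hup] at key1
  rw [hlow] at key2
  rw [hup'] at key3
  rw [integral_nashRate hx]
  obtain rfl | rfl | rfl : c = 0 ∨ c = 1 ∨ c = 2 := by fin_cases c <;> simp
  · rw [if_pos rfl, ← key1]
    congr 1
    ext θ
    simp only [Set.mem_ofPred_eq, edges_gadgetPath, mem_gadgetWalk, Set.mem_Ico]
    constructor
    · rintro ⟨h1, ⟨h2, h3⟩, h4⟩
      have hc : (0 : Fin 3) = lane (nashChoice θ j) := by simp [lane, nashChoice, h3]
      exact ⟨⟨Nat.zero_le _, Or.inl hc⟩, h1, by rwa [entryTime_lane h1 j 0 hc]⟩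
    · rintro ⟨⟨-, hc⟩, h1, h2⟩
      have hc : (0 : Fin 3) = lane (nashChoice θ j) := hc.resolve_right (by decide)
      rw [entryTime_lane h1 j 0 hc] at h2
      exact ⟨h1, ⟨iterate_doubling_nonneg h1 _, by simpa [lane, nashChoice] using hc⟩, h2⟩
  · rw [if_neg (by simp), if_pos rfl, ← key2]
    congr 1
    ext θ
    simp only [Set.mem_ofPred_eq, edges_gadgetPath, mem_gadgetWalk, Set.mem_Ici]
    constructor
    · rintro ⟨h1, h3, h4⟩
      have hc : (1 : Fin 3) = lane (nashChoice θ j) := by simp [lane, nashChoice, h3]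
      exact ⟨⟨Nat.zero_le _, Or.inl hc⟩, h1, by rwa [entryTime_lane h1 j 1 hc]⟩
    · rintro ⟨⟨-, hc⟩, h1, h2⟩
      have hc : (1 : Fin 3) = lane (nashChoice θ j) := hc.resolve_right (by decide)
      rw [entryTime_lane h1 j 1 hc] at h2
      exact ⟨h1, by simpa [lane, nashChoice] using hc, h2⟩
  · rw [if_neg (by simp), if_neg (by simp), ← key2, ← key3,
      ← measureReal_union ?_ ?_ (volume_shift_ne_top _ _ _ _) (volume_shift_ne_top _ _ _ _)]
    · congr 1
      ext θ
      simp only [Set.mem_ofPred_eq, edges_gadgetPath, mem_gadgetWalk, Set.mem_Ici, Set.mem_union,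
        Set.mem_Ico, or_true, and_true, Nat.zero_le, true_and]
      constructor
      · rintro (⟨h1, ⟨-, h2⟩, h3⟩ | ⟨h1, h2, h3⟩)
        · refine ⟨h1, ?_⟩
          rw [entryTime_last h1, if_pos h2]
          linarith
        · refine ⟨h1, ?_⟩
          rw [entryTime_last h1, if_neg (not_lt.2 h2)]
          exact h3
      · rintro ⟨h1, h2⟩
        rw [entryTime_last h1] at h2
        split_ifs at h2 with h
        · exact Or.inl ⟨h1, ⟨iterate_doubling_nonneg h1 _, h⟩, by linarith⟩
        · exact Or.inr ⟨h1, not_lt.1 h, h2⟩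
    · rw [Set.disjoint_left]
      rintro θ ⟨-, ⟨-, h⟩, -⟩ ⟨-, h', -⟩
      exact absurd h (not_lt.2 h')
    · have hm := measurable_doubling.iterate (j : ℕ)
      exact measurableSet_Ici.inter ((hm measurableSet_Ici).inter
        (measurableSet_le (hm.const_add _) measurable_const))

/-- The Nash flow over time of the gadget network. -/
def nashFlow (k : ℕ) (hk : 0 < k) : FlowOverTime (gadgetNetwork k hk) where
  pathRate P := ((fun θ => gadgetPath k hk (nashChoice θ)) ⁻¹' {P}).indicator 1
  edgeRate := nashRate k
  queue := nashQueue k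
  measurable_pathRate P := measurable_one.indicator (measurableSet_gadgetPath_nashChoice P)
  pathRate_nonneg P := Set.indicator_nonneg fun _ _ => zero_le_one
  sum_pathRate θ _ := sum_indicator_preimage_singleton _ θ
  edgeRate_nonneg e θ := by
    have h : ∀ A : Set ℝ, 0 ≤ A.indicator (1 : ℝ → ℝ) θ := fun A =>
      Set.indicator_nonneg (fun _ _ => zero_le_one) θ
    rw [nashRate]
    split_ifs
    · exact h _
    · exact h _
    · exact add_nonneg (h _) (h _)
  edgeRate_integrable e x _ := by
    rw [nashRate]
    split_ifs
    · exact intervalIntegrable_indicator_one measurableSet_Ico _ _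
    · exact intervalIntegrable_indicator_one measurableSet_Ici _ _
    · exact (intervalIntegrable_indicator_one measurableSet_Ico _ _).add
        (intervalIntegrable_indicator_one measurableSet_Ici _ _)
  queue_nonneg := nashQueue_nonneg
  queue_continuousOn e := by
    unfold nashQueue
    split_ifs <;> fun_prop
  queue_dynamics e x hx := by
    obtain ⟨j, c⟩ := e
    obtain rfl | rfl | rfl : c = 0 ∨ c = 1 ∨ c = 2 := by fin_cases c <;> simp
    · have h : ∀ y, max ((Set.Ico (j : ℝ) (j + 1)).indicator (1 : ℝ → ℝ) y - 1) 0 = 0 := fun y =>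
        max_eq_right (sub_nonpos.2 (Set.indicator_le_self' (fun _ _ => zero_le_one) y))
      simp [nashQueue, nashRate, gadgetNetwork, h]
    · have h : ∀ y, max ((Set.Ici ((j : ℝ) + 1)).indicator (1 : ℝ → ℝ) y - 1) 0 = 0 := fun y =>
        max_eq_right (sub_nonpos.2 (Set.indicator_le_self' (fun _ _ => zero_le_one) y))
      simp [nashQueue, nashRate, gadgetNetwork, h]
    · have h0 : (0 : ℝ) ≤ (j : ℕ) := Nat.cast_nonneg _
      -- Before `j + 1` nothing flows in and the queue is empty; from then on the inflow is at least
      -- the capacity, so both cases of the dynamics give the same growth rate.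
      have h : ∀ y, (if 0 < nashQueue k (j, 2) y then nashRate k (j, 2) y - (gadgetNetwork k hk).ν
          (j, 2) else max (nashRate k (j, 2) y - (gadgetNetwork k hk).ν (j, 2)) 0) =
          (Set.Ico ((j : ℝ) + 1) (j + 2)).indicator 1 y := by
        intro y
        have hν : (gadgetNetwork k hk).ν (j, 2) = 1 := rfl
        have hr : nashRate k (j, 2) = (Set.Ico ((j : ℝ) + 1) (j + 2)).indicator 1 +
            (Set.Ici ((j : ℝ) + 1)).indicator 1 := by simp [nashRate]
        rw [hν, hr, Pi.add_apply]
        rcases lt_or_ge y (j + 1) with hy | hy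
        · have hq : nashQueue k (j, 2) y = 0 := by
            simp only [nashQueue, if_true]
            exact max_eq_right (min_le_of_left_le (by linarith))
          rw [hq, Set.indicator_of_notMem (fun h => absurd h.1 (not_le.2 hy)),
            Set.indicator_of_notMem (s := Set.Ici ((j : ℝ) + 1)) (not_le.2 hy)]
          norm_num
        · rw [Set.indicator_of_mem (s := Set.Ici ((j : ℝ) + 1)) hy, Pi.one_apply,
            add_sub_cancel_right,
            max_eq_left (Set.indicator_nonneg (f := 1) (fun _ _ => zero_le_one) y), ite_self]
      simp only [h]
      rw [intervalIntegral_indicator_one measurableSet_Ico (fun y hy => by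
        have := hy.1
        simp only [Set.mem_Ici]
        linarith) hx]
      simp only [nashQueue, if_true]
      rcases lt_or_ge x (j + 2) with hx2 | hx2
      · have hs : Set.Ico ((j : ℝ) + 1) (j + 2) ∩ Set.Iic x = Set.Icc ((j : ℝ) + 1) x := by
          ext y
          exact ⟨fun h => ⟨h.1.1, h.2⟩, fun h => ⟨⟨h.1, h.2.trans_lt hx2⟩, h.2⟩⟩
        rw [hs, Real.volume_real_Icc, min_eq_left (by linarith)]
      · have hs : Set.Ico ((j : ℝ) + 1) (j + 2) ∩ Set.Iic x = Set.Ico ((j : ℝ) + 1) (j + 2) :=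
          Set.inter_eq_left.2 fun y hy => hy.2.le.trans hx2
        rw [hs, Real.volume_real_Ico_of_le (by linarith), min_eq_right (by linarith)]
        norm_num
  loading e x hx := by
    rw [loading_nash (hk := hk) e hx, sum_integral_entryTime
      (fun θ => gadgetPath k hk (nashChoice θ)) measurableSet_gadgetPath_nashChoice _ e x
      (B := {θ | 0 ≤ θ ∧ (gadgetNetwork k hk).entryTime
        (nashQueue k) (gadgetPath k hk (nashChoice θ)) e θ ≤ x}) ?_ fun _ _ => Iff.rfl]
    · rfl
    · exact fun θ hθ => ⟨hθ.1, (Network.le_traverse _ nashQueue_nonneg _ θ).trans hθ.2⟩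

theorem amount_nashFlow (k : ℕ) (hk : 0 < k) : (nashFlow k hk).amount = 2 := by
  rw [FlowOverTime.amount, (nashFlow k hk).amountBefore_of_indicator _ fun P => rfl]
  have h : {θ : ℝ | 0 ≤ θ ∧ (gadgetNetwork k hk).arrivalTime (nashFlow k hk).queue
      (gadgetPath k hk (nashChoice θ)) θ < (gadgetNetwork k hk).D} = Set.Ico 0 2 := by
    ext θ
    refine and_congr_right fun h0 => ?_
    rw [← iterate_doubling_lt_two_iff k]
    have h1 := arrivalTime_nash (hk := hk) h0
    have h2 : (gadgetNetwork k hk).D = k + 2 := rfl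
    rw [h2, ← add_lt_add_iff_left (k : ℝ) (b := doubling^[k] θ), ← h1]
    rfl
  rw [h, Real.volume_real_Ico_of_le zero_le_two, sub_zero]

/-! ### The equilibrium property. -/

/-- A particle that is too late at some gadget misses the deadline. -/
theorem le_traverse_of_late (b : ℕ → Bool) (n i : ℕ) (h : i + n = k) {y : ℝ} (hy : i + 2 ≤ y) :
    k + 2 ≤ (gadgetNetwork k hk).traverse (nashQueue k) (gadgetWalk k b n i h) y := by
  induction n generalizing i y with
  | zero =>
    obtain rfl : i = k := by omega
    exact hy
  | succ n ih =>
    rw [gadgetWalk, Network.traverse, Network.traverse]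
    refine ih (i + 1) (by omega) ?_
    have h1 := (gadgetNetwork k hk).le_exitTime nashQueue_nonneg (⟨i, by omega⟩, lane (b i)) y
    -- From time `i + 2` on the queue has mass 1, so the gadget costs at least one time unit and the
    -- delay persists.
    rw [exitTime_last, min_eq_right (by simp only; linarith), max_eq_left zero_le_one]
    push_cast
    linarith

theorem cost_lane (i : Fin k) (b : Bool) :
    (gadgetNetwork k hk).c (i, lane b) = if b then 2 ^ (k - 1 - (i : ℕ)) else 0 := by
  cases b <;> simp [gadgetNetwork, lane]

theorem sum_cost_succ (b : ℕ → Bool) (n i : ℕ) (h : i + (n + 1) = k) :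
    ((gadgetWalk k b (n + 1) i h).map (gadgetNetwork k hk).c).sum =
      (if b i then 2 ^ n else 0) +
        ((gadgetWalk k b n (i + 1) (by omega)).map (gadgetNetwork k hk).c).sum := by
  have h1 : k - 1 - i = n := by omega
  have h2 : (gadgetNetwork k hk).c (⟨i, by omega⟩, 2) = 0 := by simp [gadgetNetwork]
  rw [gadgetWalk, List.map_cons, List.map_cons, List.sum_cons, List.sum_cons, cost_lane, h1, h2,
    zero_add]

theorem sum_cost_nonneg (p : List (Fin k × Fin 3)) :
    0 ≤ (p.map (gadgetNetwork k hk).c).sum :=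
  List.sum_nonneg fun x hx => by
    obtain ⟨e, -, rfl⟩ := List.mem_map.1 hx
    exact (gadgetNetwork k hk).c_nonneg e

/-- Geometric sum: all `n` remaining lower edges together are cheaper than the preceding lower edge,
of cost `2 ^ n`. -/
theorem sum_cost_le (b : ℕ → Bool) (n i : ℕ) (h : i + n = k) :
    ((gadgetWalk k b n i h).map (gadgetNetwork k hk).c).sum ≤ 2 ^ n - 1 := by
  induction n generalizing i with
  | zero => simp [gadgetWalk]
  | succ n ih =>
    rw [sum_cost_succ, pow_succ]
    have h1 := ih (i + 1) (by omega)
    have h2 : (0 : ℝ) ≤ 2 ^ n := by positivity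
    split_ifs <;> linarith

/-- Every walk either misses the deadline or is at least as expensive as the chosen one. -/
theorem late_or_sum_cost_le {θ : ℝ} (h0 : 0 ≤ θ) (b : ℕ → Bool) (n i : ℕ) (h : i + n = k) :
    k + 2 ≤ (gadgetNetwork k hk).traverse (nashQueue k) (gadgetWalk k b n i h)
        (i + doubling^[i] θ) ∨
      ((gadgetWalk k (nashChoice θ) n i h).map (gadgetNetwork k hk).c).sum ≤
        ((gadgetWalk k b n i h).map (gadgetNetwork k hk).c).sum := by
  induction n generalizing i with
  | zero => exact Or.inr le_rfl
  | succ n ih =>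
    rw [sum_cost_succ, sum_cost_succ]
    by_cases hb : b i = nashChoice θ i
    · rw [gadgetWalk, Network.traverse, Network.traverse, hb, exitTime_nashChoice h0]
      exact (ih (i + 1) (by omega)).imp_right fun h => by linarith
    · cases hn : nashChoice θ i with
      -- The deviation pays `2 ^ n` now, more than the chosen walk pays in all later gadgets.
      | false =>
        have hb' : b i = true := by simpa [hn] using hb
        have h1 := sum_cost_le (hk := hk) (nashChoice θ) n (i + 1) (by omega)
        have h2 := sum_cost_nonneg (hk := hk) (gadgetWalk k b n (i + 1) (by omega))
        rw [hb', if_neg (by simp), if_pos rfl]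
        exact Or.inr (by linarith)
      -- The deviation reaches the last edge no earlier than `i + 2`, meets a queue of mass 1 and
      -- leaves no earlier than `(i + 1) + 2`.
      | true =>
        have hb' : b i = false := by simpa [hn] using hb
        have hw : 1 ≤ doubling^[i] θ := by simpa [nashChoice] using hn
        rw [gadgetWalk, Network.traverse, Network.traverse, hb', exitTime_upper]
        refine Or.inl (le_traverse_of_late b n (i + 1) (by omega) ?_)
        rw [exitTime_last, min_eq_right (by simp only; linarith), max_eq_left zero_le_one]
        push_cast
        linarith

theorem isNash_nashFlow (k : ℕ) (hk : 0 < k) : (nashFlow k hk).IsNash := by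
  intro θ h0 P hP Q
  have hPθ : gadgetPath k hk (nashChoice θ) = P := by
    by_contra h
    exact hP.ne' (Set.indicator_of_notMem (s := (fun θ => gadgetPath k hk (nashChoice θ)) ⁻¹' {P})
      h 1)
  subst hPθ
  obtain ⟨b, rfl⟩ := exists_eq_gadgetPath Q
  have hD : (gadgetNetwork k hk).D = k + 2 := rfl
  have hlate : ∀ Q, (gadgetNetwork k hk).D ≤ (gadgetNetwork k hk).arrivalTime
      (nashFlow k hk).queue Q θ → (nashFlow k hk).cost Q θ = ⊤ := fun Q hQ =>
    if_neg (not_lt.2 hQ)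
  rcases lt_or_ge θ 2 with h2 | h2
  · rcases late_or_sum_cost_le (hk := hk) h0 b k 0 (zero_add k) with h | h
    · rw [hlate (gadgetPath k hk b) (by
        rw [Nat.cast_zero, zero_add] at h
        exact h)]
      exact le_top
    · have hP' : (gadgetNetwork k hk).arrivalTime (nashFlow k hk).queue
          (gadgetPath k hk (nashChoice θ)) θ < (gadgetNetwork k hk).D := by
        refine (arrivalTime_nash h0).trans_lt ?_
        rw [hD]
        linarith [(iterate_doubling_lt_two_iff k).2 h2]
      rw [FlowOverTime.cost, if_pos hP', FlowOverTime.cost]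
      split_ifs
      · exact EReal.coe_le_coe_iff.2 h
      · exact le_top
  -- A particle departing at time 2 or later is late on every path, so all costs are `⊤`.
  · rw [hlate (gadgetPath k hk b)
      (le_traverse_of_late b k 0 (zero_add k) (by simpa using h2))]
    exact le_top

/-! ### The two prices of anarchy. -/

theorem one_add_half_eq (k : ℕ) : 1 + (k : ℝ≥0∞) / 2 = ENNReal.ofReal (k + 2) / 2 := by
  rw [ENNReal.ofReal_add k.cast_nonneg zero_le_two, ENNReal.ofReal_natCast, ENNReal.ofReal_ofNat,
    ENNReal.add_div, ENNReal.div_self two_ne_zero ENNReal.ofNat_ne_top, add_comm]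

theorem le_optAmount_div (k : ℕ) (hk : 0 < k) : 1 + (k : ℝ≥0∞) / 2 ≤
    (gadgetNetwork k hk).optAmount / ENNReal.ofReal (nashFlow k hk).amount := by
  rw [one_add_half_eq, amount_nashFlow, ENNReal.ofReal_ofNat]
  exact ENNReal.div_le_div_right le_optAmount _

theorem le_deadline_div_quickestTime (k : ℕ) (hk : 0 < k) {M : ℝ≥0∞} (hM : M ≤ 2) :
    1 + (k : ℝ≥0∞) / 2 ≤
      ENNReal.ofReal (gadgetNetwork k hk).D / (gadgetNetwork k hk).quickestTime M := by
  rw [one_add_half_eq]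
  exact ENNReal.div_le_div_left (quickestTime_le_two hM) _

theorem le_throughputPoA (k : ℕ) (hk : 0 < k) :
    1 + (k : ℝ≥0∞) / 2 ≤ (gadgetNetwork k hk).throughputPoA :=
  le_iSup₂_of_le (nashFlow k hk) (isNash_nashFlow k hk) (le_optAmount_div k hk)

/-- The worst Nash amount is at most the 2 units of `nashFlow`, which the all-lower flow delivers
before time 2. -/
theorem le_makespanPoA (k : ℕ) (hk : 0 < k) :
    1 + (k : ℝ≥0∞) / 2 ≤ (gadgetNetwork k hk).makespanPoA := by
  refine le_deadline_div_quickestTime k hk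
    (iInf₂_le_of_le (nashFlow k hk) (isNash_nashFlow k hk) ?_)
  rw [amount_nashFlow, ENNReal.ofReal_ofNat]

theorem exists_le_one_add_half (B : ℝ≥0) : ∃ k : ℕ, 0 < k ∧ (B : ℝ≥0∞) ≤ 1 + (k : ℝ≥0∞) / 2 := by
  obtain ⟨n, hn⟩ := exists_nat_ge B
  refine ⟨2 * (n + 1), by omega, ?_⟩
  have h : ((2 * (n + 1) : ℕ) : ℝ≥0∞) / 2 = n + 1 := by
    rw [Nat.cast_mul, Nat.cast_ofNat, ENNReal.mul_div_right_comm,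
      ENNReal.div_self two_ne_zero ENNReal.ofNat_ne_top, one_mul, Nat.cast_add, Nat.cast_one]
  rw [h]
  have hB : (B : ℝ≥0∞) ≤ n := by exact_mod_cast hn
  exact hB.trans (le_self_add.trans le_add_self)

end NashFlow

end DeadlineFlow

end

theorem mainTheorem6 :
    -- the throughput-price of anarchy is unbounded over series-parallel networks
    (∀ B : ℝ≥0, ∃ (V E : Type) (_ : Fintype V) (_ : Fintype E) (N : DeadlineFlow.Network V E),
      N.IsSeriesParallel ∧ 0 < N.worstNashAmount ∧ (B : ℝ≥0∞) ≤ N.throughputPoA) ∧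
    -- the makespan-price of anarchy is unbounded over series-parallel networks
    (∀ B : ℝ≥0, ∃ (V E : Type) (_ : Fintype V) (_ : Fintype E) (N : DeadlineFlow.Network V E),
      N.IsSeriesParallel ∧ 0 < N.worstNashAmount ∧ (B : ℝ≥0∞) ≤ N.makespanPoA) ∧
    -- the explicit family
    (∀ (k : ℕ) (hk : 0 < k),
      (DeadlineFlow.gadgetNetwork k hk).IsSeriesParallel ∧
      0 < (DeadlineFlow.gadgetNetwork k hk).worstNashAmount ∧
      (∃ f : DeadlineFlow.FlowOverTime (DeadlineFlow.gadgetNetwork k hk),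
        f.IsNash ∧ f.amount = 2 ∧
        1 + (k : ℝ≥0∞) / 2 ≤
          (DeadlineFlow.gadgetNetwork k hk).optAmount / ENNReal.ofReal f.amount ∧
        1 + (k : ℝ≥0∞) / 2 ≤ ENNReal.ofReal (DeadlineFlow.gadgetNetwork k hk).D /
          (DeadlineFlow.gadgetNetwork k hk).quickestTime (ENNReal.ofReal f.amount)) ∧
      1 + (k : ℝ≥0∞) / 2 ≤ (DeadlineFlow.gadgetNetwork k hk).throughputPoA ∧
      1 + (k : ℝ≥0∞) / 2 ≤ (DeadlineFlow.gadgetNetwork k hk).makespanPoA) := by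
  refine ⟨fun B => ?_, fun B => ?_, fun k hk => ?_⟩
  · obtain ⟨k, hk, hB⟩ := DeadlineFlow.exists_le_one_add_half B
    exact ⟨_, _, inferInstance, inferInstance, DeadlineFlow.gadgetNetwork k hk,
      DeadlineFlow.isSeriesParallel_gadgetNetwork, DeadlineFlow.worstNashAmount_pos,
      hB.trans (DeadlineFlow.le_throughputPoA k hk)⟩
  · obtain ⟨k, hk, hB⟩ := DeadlineFlow.exists_le_one_add_half B
    exact ⟨_, _, inferInstance, inferInstance, DeadlineFlow.gadgetNetwork k hk,
      DeadlineFlow.isSeriesParallel_gadgetNetwork, DeadlineFlow.worstNashAmount_pos,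
      hB.trans (DeadlineFlow.le_makespanPoA k hk)⟩
  · refine ⟨DeadlineFlow.isSeriesParallel_gadgetNetwork, DeadlineFlow.worstNashAmount_pos,
      ⟨DeadlineFlow.nashFlow k hk, DeadlineFlow.isNash_nashFlow k hk,
        DeadlineFlow.amount_nashFlow k hk, DeadlineFlow.le_optAmount_div k hk,
        DeadlineFlow.le_deadline_div_quickestTime k hk ?_⟩,
      DeadlineFlow.le_throughputPoA k hk, DeadlineFlow.le_makespanPoA k hk⟩
    rw [DeadlineFlow.amount_nashFlow, ENNReal.ofReal_ofNat]
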